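/- Let $\mathcal X,\mathcal Y$ be Polish spaces, $\mu,\nu$ Borel probability measures on $\mathcal X$ and $\mathcal Y$, and $N\ge 1$. Let $c_1,\dots,c_N:\mathcal X\times\mathcal Y\to\mathbb R$ be lower semicontinuous functions such that either all $c_i$ are nonnegative, or all $c_i$ are (strictly) negative and bounded below. Let $\Pi_{\mu,\nu}$ be the set of couplings of $\mu$ and $\nu$ (positive measures on $\mathcal X\times\mathcal Y$ with marginals $\mu$ and $\nu$), and let $\Gamma^N_{\mu,\nu}$ be the set of families $(\gamma_i)_{i=1}^N$ of positive measures on $\mathcal X\times\mathcal Y$ with $\sum_i\gamma_i\in\Pi_{\mu,\nu}$. Put $$\mathrm{EOT}_{\mathbf c}(\mu,\nu):=\inf_{(\gamma_i)\in\Gamma^N_{\mu,\nu}}\ \max_{1\le i\le N}\int c_i\,d\gamma_i\in(-\infty,+\infty].$$ 1. If $\mathrm{EOT}_{\mathbf c}(\mu,\nu)<\infty$ (which always holds when the costs are negative), then for every family $(\gamma^*_i)_{i=1}^N$ of positive measures on $\mathcal X\times\mathcal Y$ the following are equivalent: (a) $(\gamma_i^*)\in\Gamma^N_{\mu,\nu}$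 and $(\gamma_i^*)$ attains the infimum defining $\mathrm{EOT}_{\mathbf c}(\mu,\nu)$; (b) $(\gamma_i^*)$ solves the problem of minimizing $t$ over all $(\gamma_i)\in\Gamma^N_{\mu,\nu}$ and all $t$ such that $\int c_i\,d\gamma_i=t$ for every $i$. In particular, every minimizer in (a) is equitable: $\int c_i\,d\gamma_i^*=\int c_j\,d\gamma_j^*$ for all $i,j$. 2. The minimum below is attained (where $t=+\infty$ is admitted), and $$\mathrm{EOT}_{\mathbf c}(\mu,\nu)=\min_{(\gamma_i)\in\Gamma^N_{\mu,\nu}}\Big\{t\ :\ \int c_i\,d\gamma_i=t\ \text{ for all } i\Big\}.$$ 3. Suppose that the costs are negative, and let $u_i:=-c_i$. Then every minimizer $(\gamma_i^*)$ in (a) is equitable, i.e. $\int u_i\,d\gamma_i^*=\int u_j\,d\gamma^*_j$ for all $i,j$. If moreover the utilities are normalized, in the sense that for each $i$ there is $\pi_i\in\Pi_{\mu,\nu}$ with $\int u_i\,d\pi_i=1$, then every such minimizer is proportional: $\int u_i\,d\gamma_i^*\ge 1/N$ for all $i$. -/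

import Mathlib

open MeasureTheory
open scoped ENNReal

noncomputable section

/-- The integral `∫ f dγ` of a real function with values in `[-∞, +∞]`: integral of the positive part
minus integral of the negative part. For `f` bounded below and `γ` finite, the second term is finite. -/
def extIntegral {Z : Type*} [MeasurableSpace Z] (γ : Measure Z) (f : Z → ℝ) : EReal :=
  ((∫⁻ z, ENNReal.ofReal (f z) ∂γ : ℝ≥0∞) : EReal) -
    ((∫⁻ z, ENNReal.ofReal (-f z) ∂γ : ℝ≥0∞) : EReal)

/-- `LSC⁺(Z)`: nonnegative lower semicontinuous (real-valued) functions. -/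
def IsNonnegLSC {Z : Type*} [TopologicalSpace Z] (f : Z → ℝ) : Prop :=
  LowerSemicontinuous f ∧ ∀ z, 0 ≤ f z

/-- `LSC⁻_*(Z)`: (strictly) negative, bounded below, lower semicontinuous functions. -/
def IsNegBddLSC {Z : Type*} [TopologicalSpace Z] (f : Z → ℝ) : Prop :=
  LowerSemicontinuous f ∧ (∀ z, f z < 0) ∧ BddBelow (Set.range f)

section Transport

variable {X Y : Type*} [MeasurableSpace X] [MeasurableSpace Y] {N : ℕ}

/-- `Π_{μ,ν}`: couplings with marginals `μ` and `ν`. -/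
def couplings (μ : Measure X) (ν : Measure Y) : Set (Measure (X × Y)) :=
  {γ | γ.map Prod.fst = μ ∧ γ.map Prod.snd = ν}

/-- `Γ^N_{μ,ν}`: families of `N` positive measures whose sum is a coupling of `μ` and `ν`.
The members are finite as soon as `μ` is. -/
def couplingDecompositions (N : ℕ) (μ : Measure X) (ν : Measure Y) :
    Set (Fin N → Measure (X × Y)) :=
  {γ | (∑ i, γ i) ∈ couplings μ ν}

/-- `max_i ∫ c_i dγ_i`. -/
def maxCost (c : Fin N → X × Y → ℝ) (γ : Fin N → Measure (X × Y)) : EReal :=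
  ⨆ i, extIntegral (γ i) (c i)

/-- `EOT_c(μ, ν) = inf_{γ ∈ Γ^N_{μ,ν}} max_i ∫ c_i dγ_i`. -/
def EOT (c : Fin N → X × Y → ℝ) (μ : Measure X) (ν : Measure Y) : EReal :=
  ⨅ γ ∈ couplingDecompositions N μ ν, maxCost c γ

/-- `γ` is a minimizer in the definition of `EOT_c(μ, ν)`. -/
def IsEOTSolution (c : Fin N → X × Y → ℝ) (μ : Measure X) (ν : Measure Y)
    (γ : Fin N → Measure (X × Y)) : Prop :=
  γ ∈ couplingDecompositions N μ ν ∧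
    ∀ γ' ∈ couplingDecompositions N μ ν, maxCost c γ ≤ maxCost c γ'

/-- `(γ, t)` is feasible for the equality-constrained problem:
`γ ∈ Γ^N_{μ,ν}` and `∫ c_i dγ_i = t` for all `i`. -/
def IsEquitableFeasible (c : Fin N → X × Y → ℝ) (μ : Measure X) (ν : Measure Y)
    (γ : Fin N → Measure (X × Y)) (t : EReal) : Prop :=
  γ ∈ couplingDecompositions N μ ν ∧ ∀ i, extIntegral (γ i) (c i) = t

/-- `γ` solves the equality-constrained problem: it is feasible, with least common value `t`. -/
def IsEquitableSolution (c : Fin N → X × Y → ℝ) (μ : Measure X) (ν : Measure Y)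
    (γ : Fin N → Measure (X × Y)) : Prop :=
  ∃ t, IsEquitableFeasible c μ ν γ t ∧ ∀ γ' t', IsEquitableFeasible c μ ν γ' t' → t ≤ t'

end Transport

end

open Set Filter Topology TopologicalSpace

/-! ### Integrals with values in the extended reals. -/

section ExtIntegral

variable {Z : Type*} [MeasurableSpace Z]

/-! A minimizer must equalize the costs because slack at one index can be spread over the others. If
index `j` costs strictly less than the maximum, then for nonnegative costs a little mass moved to
`j` lowers every positive cost elsewhere (`exists_perturbation_of_nonneg`); for negative costs, a
little mass of `γ j` given to all members lowers every other cost (`exists_perturbation_of_neg`).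
Either way the new maximum is strictly smaller, contradicting minimality.

Existence (`exists_isEOTSolution`) is the direct method: a family of `N` measures is encoded as a
single probability measure on `Fin N × (X × Y)`, where the feasible set is weakly compact and the
maximal cost is lower semicontinuous. The equality-constrained problem then has the same value and,
when this value is finite, the same solutions. If it is infinite, `μ.prod ν` divided equally makes
every cost infinite. Proportionality follows by comparing a minimizer with the equal division of the
normalizing couplings. -/

lemma extIntegral_of_nonneg (γ : Measure Z) {f : Z → ℝ} (hf : ∀ z, 0 ≤ f z) :
    extIntegral γ f = ((∫⁻ z, ENNReal.ofReal (f z) ∂γ : ℝ≥0∞) : EReal) := by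
  have h : ∀ z, ENNReal.ofReal (-f z) = 0 := fun z => ENNReal.ofReal_of_nonpos (by linarith [hf z])
  simp [extIntegral, h]

lemma extIntegral_of_nonpos (γ : Measure Z) {f : Z → ℝ} (hf : ∀ z, f z ≤ 0) :
    extIntegral γ f = -((∫⁻ z, ENNReal.ofReal (-f z) ∂γ : ℝ≥0∞) : EReal) := by
  have h : ∀ z, ENNReal.ofReal (f z) = 0 := fun z => ENNReal.ofReal_of_nonpos (hf z)
  simp [extIntegral, h]

lemma extIntegral_neg_of_nonpos (γ : Measure Z) {f : Z → ℝ} (hf : ∀ z, f z ≤ 0) :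
    extIntegral γ (fun z => -f z) = -extIntegral γ f := by
  rw [extIntegral_of_nonpos γ hf, extIntegral_of_nonneg γ (fun z => by linarith [hf z]), neg_neg]

/-- For a function bounded below, the extended integral against a probability measure is the
lower integral of a nonnegative shift of the function. -/
lemma extIntegral_eq_lintegral_add_sub (P : Measure Z) [IsProbabilityMeasure P] {f : Z → ℝ}
    (hf : Measurable f) {M : ℝ} (hM : 0 ≤ M) (hfM : ∀ z, -M ≤ f z) :
    extIntegral P f = ((∫⁻ z, ENNReal.ofReal (f z + M) ∂P : ℝ≥0∞) : EReal) - (M : EReal) := by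
  -- The identity `(f + M) + f⁻ = f⁺ + M` involves no subtraction, so it survives infinite
  -- integrals.
  have h1 : ∫⁻ z, ENNReal.ofReal (f z + M) ∂P + ∫⁻ z, ENNReal.ofReal (-f z) ∂P =
      ∫⁻ z, ENNReal.ofReal (f z) ∂P + ENNReal.ofReal M := by
    rw [← lintegral_add_left (by fun_prop)]
    have h2 : ENNReal.ofReal M = ∫⁻ _ : Z, ENNReal.ofReal M ∂P := by simp
    rw [h2, ← lintegral_add_left (by fun_prop)]
    refine lintegral_congr fun z => ?_
    rcases le_total 0 (f z) with h | h
    · rw [ENNReal.ofReal_of_nonpos (show -f z ≤ 0 by linarith), add_zero, ENNReal.ofReal_add h hM]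
    · rw [ENNReal.ofReal_of_nonpos h, zero_add,
        ← ENNReal.ofReal_add (by linarith [hfM z]) (by linarith)]
      congr 1; ring
  have hfin : ∫⁻ z, ENNReal.ofReal (-f z) ∂P ≠ ⊤ := by
    have : ∫⁻ z, ENNReal.ofReal (-f z) ∂P ≤ ∫⁻ _ : Z, ENNReal.ofReal M ∂P :=
      lintegral_mono fun z => ENNReal.ofReal_le_ofReal (by linarith [hfM z])
    exact ne_top_of_le_ne_top (by simp) this
  rw [extIntegral]
  generalize ∫⁻ z, ENNReal.ofReal (-f z) ∂P = b at h1 hfin ⊢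
  generalize ∫⁻ z, ENNReal.ofReal (f z + M) ∂P = s at h1 ⊢
  generalize ∫⁻ z, ENNReal.ofReal (f z) ∂P = a at h1 ⊢
  lift b to NNReal using hfin
  by_cases hs : s = ⊤
  · have ha : a = ⊤ := by
      by_contra ha
      exact (ENNReal.add_ne_top.2 ⟨ha, ENNReal.ofReal_ne_top⟩) (by rw [← h1, hs]; simp)
    subst hs ha
    rw [EReal.coe_ennreal_top, EReal.coe_nnreal_eq_coe_real, EReal.top_sub_coe, EReal.top_sub_coe]
  · have ha : a ≠ ⊤ := by
      rintro rfl
      exact (ENNReal.add_ne_top.2 ⟨hs, ENNReal.coe_ne_top⟩) (by rw [h1]; simp)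
    lift s to NNReal using hs
    lift a to NNReal using ha
    have h3 := congrArg ENNReal.toReal h1
    rw [ENNReal.toReal_add (by simp) (by simp), ENNReal.toReal_add (by simp) (by simp),
      ENNReal.toReal_ofReal hM] at h3
    simp only [ENNReal.coe_toReal] at h3
    simp only [EReal.coe_nnreal_eq_coe_real]
    norm_cast
    linarith

end ExtIntegral

/-! ### Lower semicontinuity under weak convergence. -/

section WeakConvergence

variable {Ω : Type*} [TopologicalSpace Ω] [PseudoMetrizableSpace Ω] [SeparableSpace Ω]
  [MeasurableSpace Ω] [BorelSpace Ω]

/-- Lower semicontinuity, for the topology of weak convergence, of the integral of a nonnegative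
lower semicontinuous function. -/
lemma lowerSemicontinuous_lintegral_ofReal {f : Ω → ℝ} (hf : LowerSemicontinuous f)
    (hf0 : ∀ z, 0 ≤ f z) :
    LowerSemicontinuous fun P : ProbabilityMeasure Ω =>
      ∫⁻ z, ENNReal.ofReal (f z) ∂(P : Measure Ω) := by
  rw [lowerSemicontinuous_iff_le_liminf]
  intro P
  -- Pseudometrizability makes `𝓝 P` countably generated, as needed for Fatou's lemma along this
  -- filter. The layer-cake formula reduces the integrand to open superlevel sets, where the
  -- portmanteau theorem applies.
  let := pseudoMetrizableSpacePseudoMetric (ProbabilityMeasure Ω)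
  simp_rw [lintegral_eq_lintegral_meas_lt _ (Eventually.of_forall hf0) hf.measurable.aemeasurable]
  calc ∫⁻ (t : ℝ) in Ioi 0, (P : Measure Ω) {a | t < f a}
      ≤ ∫⁻ (t : ℝ) in Ioi 0,
          liminf (fun Q : ProbabilityMeasure Ω => (Q : Measure Ω) {a | t < f a}) (𝓝 P) :=
        lintegral_mono fun t => ProbabilityMeasure.le_liminf_measure_open_of_tendsto
          (μs := fun Q => Q) tendsto_id (hf.isOpen_preimage t)
    _ ≤ _ := lintegral_liminf_le fun Q => Antitone.measurable fun s t hst =>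
        measure_mono fun ω hω => lt_of_le_of_lt hst hω

/-- Lower semicontinuity, for the topology of weak convergence, of the integral of a lower
semicontinuous function bounded below. -/
lemma lowerSemicontinuous_extIntegral {f : Ω → ℝ} (hf : LowerSemicontinuous f) {M : ℝ}
    (hM : 0 ≤ M) (hfM : ∀ z, -M ≤ f z) :
    LowerSemicontinuous fun P : ProbabilityMeasure Ω => extIntegral (P : Measure Ω) f := by
  simp_rw [fun P : ProbabilityMeasure Ω =>
    extIntegral_eq_lintegral_add_sub (P : Measure Ω) hf.measurable hM hfM]
  have h1 := lowerSemicontinuous_lintegral_ofReal (f := fun z => f z + M)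
    (hf.add lowerSemicontinuous_const) (fun z => by linarith [hfM z])
  have h2 : Continuous fun x : ℝ≥0∞ => (x : EReal) - (M : EReal) := by
    rw [continuous_iff_continuousAt]
    intro x
    simp only [sub_eq_add_neg]
    rw [← EReal.coe_neg]
    exact (EReal.continuousAt_add (Or.inr (EReal.coe_ne_bot _)) (Or.inr (EReal.coe_ne_top _))).comp
      (f := fun x : ℝ≥0∞ => ((x : EReal), ((-M : ℝ) : EReal)))
      (continuous_coe_ennreal_ereal.continuousAt.prodMk continuousAt_const)
  exact h2.comp_lowerSemicontinuous h1 fun x y hxy =>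
    EReal.sub_le_sub (EReal.coe_ennreal_le_coe_ennreal_iff.2 hxy) le_rfl

end WeakConvergence

/-! ### Decompositions of couplings and cost-decreasing perturbations. -/

section Decompositions

variable {X Y : Type*} [MeasurableSpace X] [MeasurableSpace Y] {N : ℕ}
  {μ : Measure X} {ν : Measure Y}

lemma prod_mem_couplings (μ : Measure X) (ν : Measure Y) [IsProbabilityMeasure μ]
    [IsProbabilityMeasure ν] : μ.prod ν ∈ couplings μ ν := by
  constructor
  · change (μ.prod ν).fst = μ
    simp
  · change (μ.prod ν).snd = ν
    simp

lemma single_mem_couplingDecompositions {π : Measure (X × Y)} (hπ : π ∈ couplings μ ν)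
    (i : Fin N) : Pi.single i π ∈ couplingDecompositions N μ ν := by
  simpa [couplingDecompositions, Finset.sum_pi_single'] using hπ

/-- This competitor serves both the infinite-value case and the proportionality bound. -/
lemma average_mem_couplingDecompositions (hN : 1 ≤ N) {π : Fin N → Measure (X × Y)}
    (hπ : ∀ i, π i ∈ couplings μ ν) :
    (fun i => (N : ℝ≥0∞)⁻¹ • π i) ∈ couplingDecompositions N μ ν := by
  have hN' : (N : ℝ≥0∞) * (N : ℝ≥0∞)⁻¹ = 1 :=
    ENNReal.mul_inv_cancel (by simp; omega) (by simp)
  constructor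
  · ext s hs
    rw [Measure.map_apply measurable_fst hs, Measure.finsetSum_apply]
    have h i : π i (Prod.fst ⁻¹' s) = μ s := by
      rw [← (hπ i).1, Measure.map_apply measurable_fst hs]
    simp [h, ← mul_assoc, hN']
  · ext s hs
    rw [Measure.map_apply measurable_snd hs, Measure.finsetSum_apply]
    have h i : π i (Prod.snd ⁻¹' s) = ν s := by
      rw [← (hπ i).2, Measure.map_apply measurable_snd hs]
    simp [h, ← mul_assoc, hN']

lemma isProbabilityMeasure_of_mem_couplings [IsProbabilityMeasure μ] {π : Measure (X × Y)}
    (hπ : π ∈ couplings μ ν) : IsProbabilityMeasure π := by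
  have : IsProbabilityMeasure (π.map Prod.fst) := by rw [hπ.1]; infer_instance
  exact Measure.isProbabilityMeasure_of_map Prod.fst

lemma isFiniteMeasure_of_mem_couplingDecompositions [IsProbabilityMeasure μ]
    {γ : Fin N → Measure (X × Y)} (hγ : γ ∈ couplingDecompositions N μ ν) (i : Fin N) :
    IsFiniteMeasure (γ i) := by
  have := isProbabilityMeasure_of_mem_couplings hγ
  exact isFiniteMeasure_of_le (∑ i, γ i)
    (Finset.single_le_sum (fun _ _ => Measure.zero_le _) (Finset.mem_univ i))

lemma maxCost_eq_extIntegral (hN : 1 ≤ N) (c : Fin N → X × Y → ℝ)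
    (γ : Fin N → Measure (X × Y)) : ∃ i, maxCost c γ = extIntegral (γ i) (c i) := by
  have : Nonempty (Fin N) := ⟨⟨0, hN⟩⟩
  obtain ⟨i, hi⟩ := exists_eq_ciSup_of_finite (f := fun i => extIntegral (γ i) (c i))
  exact ⟨i, hi.symm⟩

lemma extIntegral_le_maxCost (c : Fin N → X × Y → ℝ) (γ : Fin N → Measure (X × Y)) (i : Fin N) :
    extIntegral (γ i) (c i) ≤ maxCost c γ :=
  le_iSup (fun i => extIntegral (γ i) (c i)) i

lemma IsEOTSolution.maxCost_eq {c : Fin N → X × Y → ℝ} {γ : Fin N → Measure (X × Y)}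
    (h : IsEOTSolution c μ ν γ) : maxCost c γ = EOT c μ ν :=
  le_antisymm (le_iInf₂ h.2) (iInf₂_le γ h.1)

lemma IsEquitableFeasible.maxCost_eq (hN : 1 ≤ N) {c : Fin N → X × Y → ℝ}
    {γ : Fin N → Measure (X × Y)} {t : EReal} (h : IsEquitableFeasible c μ ν γ t) :
    maxCost c γ = t := by
  obtain ⟨i, hi⟩ := maxCost_eq_extIntegral hN c γ
  rw [hi, h.2]

/-- A minimizer is equitable as soon as every non-equitable family can be perturbed so as to
decrease the maximal cost. -/
lemma IsEOTSolution.extIntegral_eq_of_perturbation (hN : 1 ≤ N) {c : Fin N → X × Y → ℝ}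
    {γ : Fin N → Measure (X × Y)} (h : IsEOTSolution c μ ν γ)
    (hp : ∀ j, extIntegral (γ j) (c j) < maxCost c γ → ∃ γ' ∈ couplingDecompositions N μ ν,
      ∀ i, extIntegral (γ' i) (c i) < maxCost c γ) (i : Fin N) :
    extIntegral (γ i) (c i) = EOT c μ ν := by
  rw [← h.maxCost_eq]
  refine (extIntegral_le_maxCost c γ i).eq_of_not_lt fun hlt => ?_
  obtain ⟨γ', hγ', hlt'⟩ := hp i hlt
  obtain ⟨k, hk⟩ := maxCost_eq_extIntegral hN c γ'
  exact ((h.2 γ' hγ').trans_eq hk).not_gt (hlt' k)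

/-- For nonnegative costs, a family can be perturbed by moving a little mass to a member whose cost
is not maximal. -/
lemma exists_perturbation_of_nonneg [IsProbabilityMeasure μ]
    {c : Fin N → X × Y → ℝ} (hm : ∀ i, Measurable (c i)) (hc : ∀ i z, 0 ≤ c i z)
    {γ : Fin N → Measure (X × Y)} (hγ : γ ∈ couplingDecompositions N μ ν)
    (hfin : maxCost c γ < ⊤) (j : Fin N) (hj : extIntegral (γ j) (c j) < maxCost c γ) :
    ∃ γ' ∈ couplingDecompositions N μ ν, ∀ i, extIntegral (γ' i) (c i) < maxCost c γ := by
  have hle := extIntegral_le_maxCost c γ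
  have hprob := isProbabilityMeasure_of_mem_couplings hγ
  simp only [extIntegral_of_nonneg _ (hc _)] at hle hj ⊢
  generalize maxCost c γ = m' at hfin hle hj ⊢
  have hm0 : 0 ≤ m' := (EReal.coe_ennreal_nonneg _).trans hj.le
  lift m' to ℝ≥0∞ using hm0 with m
  simp only [EReal.coe_ennreal_le_coe_ennreal_iff, EReal.coe_ennreal_lt_coe_ennreal_iff] at *
  have hmtop : m ≠ ⊤ := by rintro rfl; simp at hfin
  -- `δ ≤ 1` keeps the moved fraction `w` at most one; `δ` below the gap keeps the cost of `j` below
  -- `m`.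
  obtain ⟨δ, hδ0, hδ⟩ : ∃ δ : ℝ≥0∞, 0 < δ ∧ δ < min 1 (m - ∫⁻ z, ENNReal.ofReal (c j z) ∂γ j) :=
    exists_between (lt_min one_pos (tsub_pos_of_lt hj))
  have hδ1 : δ ≤ 1 := (hδ.trans_le (min_le_left _ _)).le
  have hδm : ∫⁻ z, ENNReal.ofReal (c j z) ∂γ j + δ < m := by
    rw [add_comm]
    exact lt_tsub_iff_right.1 (hδ.trans_le (min_le_right _ _))
  -- Since `c j` may be unbounded or non-integrable against the other members, the fraction moved is
  -- damped by `1 + c j`. The moved mass then costs at most `δ` under `c j`, and `w` is still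
  -- positive everywhere.
  set w : X × Y → ℝ≥0∞ := fun z => δ / (1 + ENNReal.ofReal (c j z)) with hw
  have hwm : Measurable w := by have := hm j; fun_prop
  have hw0 : ∀ z, w z ≠ 0 := fun z => by
    rw [hw]; simp only [ne_eq, ENNReal.div_eq_zero_iff, not_or]
    exact ⟨hδ0.ne', by simp⟩
  have hwδ : ∀ z, w z * (1 + ENNReal.ofReal (c j z)) = δ := fun z =>
    ENNReal.div_mul_cancel (by simp) (by simp)
  have hw1 : ∀ z, w z ≤ 1 := fun z => by
    refine le_trans ?_ hδ1
    rw [← hwδ z]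
    exact le_mul_of_one_le_right' (by simp)
  have hwc : ∀ z, w z * ENNReal.ofReal (c j z) ≤ δ := fun z => by
    rw [← hwδ z]
    gcongr
    simp
  have hsplit : ∀ i, (γ i).withDensity (fun z => 1 - w z) + (γ i).withDensity w = γ i := fun i => by
    rw [← withDensity_add_right _ hwm]
    have : (fun z => 1 - w z) + w = 1 := by
      funext z
      exact tsub_add_cancel_of_le (hw1 z)
    rw [this, withDensity_one]
  set η : Fin N → Measure (X × Y) := fun i => (γ i).withDensity w with hη
  refine ⟨fun i => (if i = j then γ j else (γ i).withDensity fun z => 1 - w z) +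
    if i = j then ∑ k ∈ Finset.univ.erase j, η k else 0, ?_, ?_⟩
  · have hsum : ∑ i, ((if i = j then γ j else (γ i).withDensity fun z => 1 - w z) +
        if i = j then ∑ k ∈ Finset.univ.erase j, η k else 0) = ∑ i, γ i := by
      rw [← Finset.add_sum_erase _ _ (Finset.mem_univ j),
        ← Finset.add_sum_erase _ γ (Finset.mem_univ j)]
      simp only [if_true, add_assoc]
      rw [← Finset.sum_add_distrib]
      congr 1
      refine Finset.sum_congr rfl fun k hk => ?_
      rw [if_neg (Finset.ne_of_mem_erase hk), if_neg (Finset.ne_of_mem_erase hk), add_zero, add_comm]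
      exact hsplit k
    change (∑ i, _) ∈ couplings μ ν
    rw [hsum]
    exact hγ
  · intro i
    by_cases hij : i = j
    · subst hij
      simp only [if_true]
      rw [lintegral_add_measure]
      refine lt_of_le_of_lt (add_le_add_right ?_ _) hδm
      rw [lintegral_finsetSum_measure]
      calc ∑ k ∈ Finset.univ.erase i, ∫⁻ z, ENNReal.ofReal (c i z) ∂η k
          ≤ ∑ k ∈ Finset.univ.erase i, δ * γ k univ := by
            refine Finset.sum_le_sum fun k _ => ?_
            rw [hη, lintegral_withDensity_eq_lintegral_mul _ hwm (by have := hm i; fun_prop),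
              ← lintegral_const]
            exact lintegral_mono hwc
        _ ≤ ∑ k, δ * γ k univ := Finset.sum_le_sum_of_subset (Finset.erase_subset _ _)
        _ = δ * (∑ k, γ k) univ := by rw [Measure.finsetSum_apply, Finset.mul_sum]
        _ = δ := by rw [measure_univ, mul_one]
    · simp only [if_neg hij, add_zero]
      have hadd : ∫⁻ z, ENNReal.ofReal (c i z) ∂(γ i).withDensity (fun z => 1 - w z) +
          ∫⁻ z, ENNReal.ofReal (c i z) ∂η i = ∫⁻ z, ENNReal.ofReal (c i z) ∂γ i := by
        rw [← lintegral_add_measure, hsplit]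
      have hifin : ∫⁻ z, ENNReal.ofReal (c i z) ∂γ i ≠ ⊤ := ne_top_of_le_ne_top hmtop (hle i)
      -- If the mass removed from `γ i` carries no `c i`-cost, positivity of `w` forces the whole
      -- cost of `i` to vanish, and `0 < m` suffices. Otherwise a finite cost strictly drops.
      by_cases h0 : ∫⁻ z, ENNReal.ofReal (c i z) ∂η i = 0
      · have h1 : ∫⁻ z, ENNReal.ofReal (c i z) ∂γ i = 0 := by
          have hci : Measurable fun z => ENNReal.ofReal (c i z) := by have := hm i; fun_prop
          rw [hη, lintegral_withDensity_eq_lintegral_mul _ hwm hci,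
            lintegral_eq_zero_iff (hwm.mul hci)] at h0
          rw [lintegral_eq_zero_iff hci]
          filter_upwards [h0] with z hz
          exact (mul_eq_zero.1 hz).resolve_left (hw0 z)
        rw [h1, h0, add_zero] at hadd
        rw [hadd]
        exact zero_le.trans_lt hj
      · refine lt_of_lt_of_le ?_ (hle i)
        rw [← hadd] at hifin ⊢
        exact ENNReal.lt_add_right (ENNReal.add_ne_top.1 hifin).1 h0

/-- For negative costs bounded below, a family can be perturbed by moving a little mass from a
member whose cost is not maximal. -/
lemma exists_perturbation_of_neg [IsProbabilityMeasure μ]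
    {c : Fin N → X × Y → ℝ} (hm : ∀ i, Measurable (c i)) (hc : ∀ i z, c i z < 0)
    (hbdd : ∀ i, BddBelow (range (c i)))
    {γ : Fin N → Measure (X × Y)} (hγ : γ ∈ couplingDecompositions N μ ν)
    (j : Fin N) (hj : extIntegral (γ j) (c j) < maxCost c γ) :
    ∃ γ' ∈ couplingDecompositions N μ ν, ∀ i, extIntegral (γ' i) (c i) < maxCost c γ := by
  have hN : 1 ≤ N := j.pos
  obtain ⟨k, hk⟩ := maxCost_eq_extIntegral hN c γ
  have hle := extIntegral_le_maxCost c γ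
  have hfm := isFiniteMeasure_of_mem_couplingDecompositions hγ
  rw [hk] at hj hle ⊢
  simp only [extIntegral_of_nonpos _ (fun z => (hc _ z).le), EReal.neg_lt_neg_iff,
    EReal.neg_le_neg_iff, EReal.coe_ennreal_le_coe_ennreal_iff,
    EReal.coe_ennreal_lt_coe_ennreal_iff] at hj hle ⊢
  set b : ℝ≥0∞ := ∫⁻ z, ENNReal.ofReal (-c j z) ∂γ j with hb
  have hfin : ∀ i l, ∫⁻ z, ENNReal.ofReal (-c i z) ∂γ l ≠ ⊤ := fun i l => by
    obtain ⟨M, hM⟩ := hbdd i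
    have h1 : ∫⁻ z, ENNReal.ofReal (-c i z) ∂γ l ≤ ∫⁻ _, ENNReal.ofReal (-M) ∂γ l :=
      lintegral_mono fun z => ENNReal.ofReal_le_ofReal (neg_le_neg (hM ⟨z, rfl⟩))
    refine ne_top_of_le_ne_top ?_ h1
    rw [lintegral_const]
    exact ENNReal.mul_ne_top ENNReal.ofReal_ne_top (measure_ne_top _ _)
  have hb0 : b ≠ 0 := (hj.trans_le' zero_le).ne'
  -- `j` keeps the fraction `r` of its mass, with `r` so close to one that its utility still exceeds
  -- the least utility, that of `k`.
  obtain ⟨r, hr, hr1⟩ := exists_between ((ENNReal.div_lt_iff (Or.inl hb0) (Or.inl (hfin j j))).2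
    (by rwa [one_mul] : _ < 1 * b))
  rw [ENNReal.div_lt_iff (Or.inl hb0) (Or.inl (hfin j j))] at hr
  -- The released mass is shared by all `N` members, `j` included, so that the shares add up to `1 -
  -- r`.
  set s : ℝ≥0∞ := (N : ℝ≥0∞)⁻¹ * (1 - r) with hs
  have hs0 : s ≠ 0 := mul_ne_zero (by simp) (tsub_pos_of_lt hr1).ne'
  have hNs : (N : ℝ≥0∞) * s = 1 - r := by
    rw [hs, ← mul_assoc, ENNReal.mul_inv_cancel (by simp; omega) (by simp), one_mul]
  have hγj : γ j ≠ 0 := fun h => hb0 (by rw [hb, h, lintegral_zero_measure])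
  refine ⟨fun i => (if i = j then r • γ j else γ i) + s • γ j, ?_, fun i => ?_⟩
  · have hsum : ∑ i, ((if i = j then r • γ j else γ i) + s • γ j) = ∑ i, γ i := by
      rw [Finset.sum_add_distrib, ← Finset.add_sum_erase _ _ (Finset.mem_univ j),
        ← Finset.add_sum_erase _ γ (Finset.mem_univ j), if_pos rfl,
        Finset.sum_congr rfl fun k hk => if_neg (Finset.ne_of_mem_erase hk), add_right_comm]
      congr 1
      rw [Finset.sum_const, Finset.card_univ, Fintype.card_fin, ← Nat.cast_smul_eq_nsmul ℝ≥0∞,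
        smul_smul, hNs, ← add_smul, add_tsub_cancel_of_le hr1.le, one_smul]
    change (∑ i, _) ∈ couplings μ ν
    rw [hsum]
    exact hγ
  · by_cases hij : i = j
    · subst hij
      simp only [if_true]
      rw [lintegral_add_measure, lintegral_smul_measure]
      exact hr.trans_le le_self_add
    · simp only [if_neg hij]
      rw [lintegral_add_measure, lintegral_smul_measure]
      refine (hle i).trans_lt (ENNReal.lt_add_right (hfin i i) (mul_ne_zero hs0 ?_))
      have hci : Measurable fun z => ENNReal.ofReal (-c i z) := by have := hm i; fun_prop
      rw [Ne, lintegral_eq_zero_iff hci]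
      -- Strict negativity is used here: `-c i` vanishes nowhere, so its integral against the
      -- nonzero `γ j` is positive.
      intro h
      refine hγj (ae_eq_bot.1 (Filter.eventually_false_iff_eq_bot.1 ?_))
      filter_upwards [h] with z hz
      have := ENNReal.ofReal_eq_zero.1 hz
      linarith [hc i z]

end Decompositions

/-! ### Existence of a minimizer by weak compactness. -/

section Existence

variable {X Y : Type*} [MeasurableSpace X] [MeasurableSpace Y] {N : ℕ}
  {μ : Measure X} {ν : Measure Y}

/-- A family of functions on `Z` as a family of functions on the disjoint union of copies of `Z`,
the `i`-th one being supported on the `i`-th copy. -/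
noncomputable def costOnCopy {Z : Type*} (c : Fin N → Z → ℝ) (i : Fin N) (p : Fin N × Z) : ℝ :=
  if p.1 = i then c i p.2 else 0

/-- The component of index `i` of a measure on a disjoint union. -/
noncomputable def copyComponent {Z : Type*} [MeasurableSpace Z] (P : Measure (Fin N × Z)) (i : Fin N) :
    Measure Z :=
  (P.restrict (Prod.fst ⁻¹' {i})).map Prod.snd

lemma sum_copyComponent {Z : Type*} [MeasurableSpace Z] (P : Measure (Fin N × Z)) :
    ∑ i, copyComponent P i = P.map Prod.snd := by
  ext s hs
  rw [Measure.finsetSum_apply, Measure.map_apply measurable_snd hs]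
  simp only [copyComponent]
  have h i : ((P.restrict (Prod.fst ⁻¹' {i})).map Prod.snd) s =
      P.restrict (Prod.snd ⁻¹' s) (Prod.fst ⁻¹' {i}) := by
    rw [Measure.map_apply measurable_snd hs, Measure.restrict_apply (measurable_snd hs),
      Measure.restrict_apply (measurable_fst (measurableSet_singleton i)), inter_comm]
  simp only [h]
  rw [sum_measure_preimage_singleton _ fun i _ => measurable_fst (measurableSet_singleton i)]
  simp

/-- The measure on the disjoint union with given components. -/
noncomputable def ofCopyComponents {Z : Type*} [MeasurableSpace Z] (γ : Fin N → Measure Z) :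
    Measure (Fin N × Z) :=
  ∑ i, (γ i).map (Prod.mk i)

lemma map_snd_ofCopyComponents {Z : Type*} [MeasurableSpace Z] (γ : Fin N → Measure Z) :
    (ofCopyComponents γ).map Prod.snd = ∑ i, γ i := by
  ext s hs
  rw [Measure.map_apply measurable_snd hs, ofCopyComponents, Measure.finsetSum_apply,
    Measure.finsetSum_apply]
  refine Finset.sum_congr rfl fun i _ => ?_
  rw [Measure.map_apply measurable_prodMk_left (measurable_snd hs)]
  rfl

lemma copyComponent_ofCopyComponents {Z : Type*} [MeasurableSpace Z] (γ : Fin N → Measure Z)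
    (i : Fin N) : copyComponent (ofCopyComponents γ) i = γ i := by
  ext s hs
  rw [copyComponent, Measure.map_apply measurable_snd hs,
    Measure.restrict_apply (measurable_snd hs), ofCopyComponents, Measure.finsetSum_apply,
    Finset.sum_eq_single i]
  · rw [Measure.map_apply measurable_prodMk_left
      ((measurable_snd hs).inter (measurable_fst (measurableSet_singleton i)))]
    congr 1
    ext z
    simp
  · intro k _ hk
    rw [Measure.map_apply measurable_prodMk_left
      ((measurable_snd hs).inter (measurable_fst (measurableSet_singleton i)))]
    convert measure_empty (μ := γ k)
    ext z
    simp [hk]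
  · simp

lemma extIntegral_copyComponent {Z : Type*} [MeasurableSpace Z] (P : Measure (Fin N × Z))
    {c : Fin N → Z → ℝ} (i : Fin N) (hc : Measurable (c i)) :
    extIntegral (copyComponent P i) (c i) = extIntegral P (costOnCopy c i) := by
  have hi : MeasurableSet (Prod.fst ⁻¹' {i} : Set (Fin N × Z)) :=
    measurable_fst (measurableSet_singleton i)
  have h1 : ∫⁻ z, ENNReal.ofReal (c i z) ∂copyComponent P i =
      ∫⁻ p, ENNReal.ofReal (costOnCopy c i p) ∂P := by
    rw [copyComponent, lintegral_map (by fun_prop) measurable_snd, ← lintegral_indicator hi]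
    refine lintegral_congr fun p => ?_
    by_cases hp : p.1 = i <;> simp [costOnCopy, hp]
  have h2 : ∫⁻ z, ENNReal.ofReal (-c i z) ∂copyComponent P i =
      ∫⁻ p, ENNReal.ofReal (-costOnCopy c i p) ∂P := by
    rw [copyComponent, lintegral_map (by fun_prop) measurable_snd, ← lintegral_indicator hi]
    refine lintegral_congr fun p => ?_
    by_cases hp : p.1 = i <;> simp [costOnCopy, hp]
  rw [extIntegral, extIntegral, h1, h2]

/-- Each copy is clopen because `Fin N` is discrete, so extension by zero creates no bad jumps,
whatever the sign of the cost. -/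
lemma lowerSemicontinuous_costOnCopy {Z : Type*} [TopologicalSpace Z] {c : Fin N → Z → ℝ}
    (i : Fin N) (hc : LowerSemicontinuous (c i)) : LowerSemicontinuous (costOnCopy c i) := by
  intro p y hy
  have hnhds : ∀ᶠ q : Fin N × Z in 𝓝 p, q.1 = p.1 :=
    continuous_fst.continuousAt.eventually (IsOpen.mem_nhds (isOpen_discrete {p.1}) rfl)
  by_cases hp : p.1 = i
  · simp only [costOnCopy, if_pos hp] at hy
    filter_upwards [hnhds, continuous_snd.continuousAt.eventually (hc p.2 y hy)] with q hq1 hq2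
    simpa only [costOnCopy, if_pos (hq1.trans hp)] using hq2
  · simp only [costOnCopy, if_neg hp] at hy
    filter_upwards [hnhds] with q hq1
    rw [← hq1] at hp
    simpa only [costOnCopy, if_neg hp] using hy

variable [TopologicalSpace X] [PolishSpace X] [BorelSpace X]
  [TopologicalSpace Y] [PolishSpace Y] [BorelSpace Y]

/-- Weak compactness of the set of measures on a disjoint union of copies of `X × Y` whose
projection is a coupling. -/
lemma isCompact_setOf_map_snd_mem_couplings (N : ℕ) (μ : Measure X) [IsProbabilityMeasure μ]
    (ν : Measure Y) [IsProbabilityMeasure ν] :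
    IsCompact {P : ProbabilityMeasure (Fin N × (X × Y)) |
      (P : Measure (Fin N × (X × Y))).map Prod.snd ∈ couplings μ ν} := by
  set S := {P : ProbabilityMeasure (Fin N × (X × Y)) |
    (P : Measure (Fin N × (X × Y))).map Prod.snd ∈ couplings μ ν} with hS
  let μ' : ProbabilityMeasure X := ⟨μ, inferInstance⟩
  let ν' : ProbabilityMeasure Y := ⟨ν, inferInstance⟩
  have hf : Continuous fun p : Fin N × (X × Y) => p.2.1 := by fun_prop
  have hg : Continuous fun p : Fin N × (X × Y) => p.2.2 := by fun_prop
  have hclosed : IsClosed S := by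
    have : S = {P | P.map hf.measurable.aemeasurable = μ'} ∩
        {P | P.map hg.measurable.aemeasurable = ν'} := by
      ext P
      simp only [hS, couplings, mem_ofPred_eq, mem_inter_iff]
      rw [Measure.map_map measurable_fst measurable_snd,
        Measure.map_map measurable_snd measurable_snd]
      exact and_congr (Subtype.ext_iff (a1 := P.map hf.measurable.aemeasurable) (a2 := μ')).symm
        (Subtype.ext_iff (a1 := P.map hg.measurable.aemeasurable) (a2 := ν')).symm
    rw [this]
    exact (isClosed_singleton.preimage (ProbabilityMeasure.continuous_map hf)).inter
      (isClosed_singleton.preimage (ProbabilityMeasure.continuous_map hg))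
  rw [← hclosed.closure_eq]
  apply isCompact_closure_of_isTightMeasureSet
  -- Tightness can be checked on marginals: the index space is compact, and the other two marginals
  -- are the fixed measures `μ` and `ν`.
  refine IsTightMeasureSet.prodMk IsTightMeasureSet.of_compactSpace ?_
  refine IsTightMeasureSet.prodMk ((isTightMeasureSet_singleton (μ := μ)).subset ?_)
    ((isTightMeasureSet_singleton (μ := ν)).subset ?_)
  · rintro _ ⟨_, ⟨_, ⟨P, hP, rfl⟩, rfl⟩, rfl⟩
    exact hP.1
  · rintro _ ⟨_, ⟨_, ⟨P, hP, rfl⟩, rfl⟩, rfl⟩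
    exact hP.2

/-- The equitable optimal transport problem has a minimizer, for lower semicontinuous costs bounded
below. -/
lemma exists_isEOTSolution [IsProbabilityMeasure μ] [IsProbabilityMeasure ν] (hN : 1 ≤ N)
    {c : Fin N → X × Y → ℝ} (hc : ∀ i, LowerSemicontinuous (c i))
    (hbdd : ∀ i, BddBelow (range (c i))) : ∃ γ, IsEOTSolution c μ ν γ := by
  have hlsc : LowerSemicontinuous fun P : ProbabilityMeasure (Fin N × (X × Y)) =>
      ⨆ i, extIntegral (P : Measure (Fin N × (X × Y))) (costOnCopy c i) := by
    refine lowerSemicontinuous_iSup fun i => ?_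
    obtain ⟨M, hM⟩ := hbdd i
    -- The bound `-|M|` also covers the value zero taken on the other copies.
    refine lowerSemicontinuous_extIntegral (lowerSemicontinuous_costOnCopy i (hc i))
      (abs_nonneg M) fun p => ?_
    have hM' := neg_abs_le M
    unfold costOnCopy
    split_ifs
    · exact hM'.trans (hM ⟨p.2, rfl⟩)
    · linarith [abs_nonneg M]
  have key : ∀ γ ∈ couplingDecompositions N μ ν, ∃ P : ProbabilityMeasure (Fin N × (X × Y)),
      (P : Measure (Fin N × (X × Y))).map Prod.snd ∈ couplings μ ν ∧
      (⨆ i, extIntegral (P : Measure (Fin N × (X × Y))) (costOnCopy c i)) = maxCost c γ := by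
    intro γ hγ
    have hmap : (ofCopyComponents γ).map Prod.snd ∈ couplings μ ν := by
      rw [map_snd_ofCopyComponents]
      exact hγ
    have h1 := isProbabilityMeasure_of_mem_couplings hmap
    have h2 : IsProbabilityMeasure (ofCopyComponents γ) :=
      Measure.isProbabilityMeasure_of_map Prod.snd
    refine ⟨⟨ofCopyComponents γ, h2⟩, hmap, ?_⟩
    refine iSup_congr fun i => ?_
    have h := extIntegral_copyComponent (ofCopyComponents γ) i (hc i).measurable
    rw [copyComponent_ofCopyComponents] at h
    exact h.symm
  obtain ⟨P, hP, hmin⟩ := (hlsc.lowerSemicontinuousOn _).exists_isMinOn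
    (by
      obtain ⟨P, hP, -⟩ := key _ (single_mem_couplingDecompositions (prod_mem_couplings μ ν)
        ⟨0, hN⟩)
      exact ⟨P, hP⟩)
    (isCompact_setOf_map_snd_mem_couplings N μ ν)
  refine ⟨copyComponent (P : Measure (Fin N × (X × Y))), ?_, fun γ hγ => ?_⟩
  · change ∑ i, _ ∈ couplings μ ν
    rw [sum_copyComponent]
    exact hP
  · obtain ⟨Q, hQ, hQγ⟩ := key γ hγ
    rw [← hQγ]
    refine le_trans (le_of_eq ?_) (hmin hQ)
    exact iSup_congr fun i => extIntegral_copyComponent _ i (hc i).measurable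

end Existence

/-! ### Equitability, attainment and proportionality. -/

theorem proposition1 {X Y : Type*}
    [TopologicalSpace X] [PolishSpace X] [MeasurableSpace X] [BorelSpace X]
    [TopologicalSpace Y] [PolishSpace Y] [MeasurableSpace Y] [BorelSpace Y]
    (μ : Measure X) [IsProbabilityMeasure μ] (ν : Measure Y) [IsProbabilityMeasure ν]
    (N : ℕ) (hN : 1 ≤ N) (c : Fin N → X × Y → ℝ)
    (hc : (∀ i, IsNonnegLSC (c i)) ∨ (∀ i, IsNegBddLSC (c i))) :
    -- the two problems have the same solutions, and the solutions are equitable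
    (EOT c μ ν < ⊤ →
      (∀ γ : Fin N → Measure (X × Y), IsEOTSolution c μ ν γ ↔ IsEquitableSolution c μ ν γ) ∧
      (∀ γ : Fin N → Measure (X × Y), IsEOTSolution c μ ν γ →
        ∀ i j, extIntegral (γ i) (c i) = extIntegral (γ j) (c j))) ∧
    -- the equality-constrained minimum exists and is `EOT`
    IsLeast {t : EReal | ∃ γ : Fin N → Measure (X × Y), IsEquitableFeasible c μ ν γ t}
      (EOT c μ ν) ∧
    -- for negative costs, finiteness holds, and solutions are equitable and, if the utilities `-c i`
    -- are normalized, proportional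
    ((∀ i, IsNegBddLSC (c i)) →
      EOT c μ ν < ⊤ ∧
      ∀ γ : Fin N → Measure (X × Y), IsEOTSolution c μ ν γ →
        (∀ i j, extIntegral (γ i) (fun z => -c i z) = extIntegral (γ j) (fun z => -c j z)) ∧
        ((∀ i, ∃ π ∈ couplings μ ν, extIntegral π (fun z => -c i z) = 1) →
          ∀ i, ((1 / (N : ℝ) : ℝ) : EReal) ≤ extIntegral (γ i) (fun z => -c i z))) := by
  have hmeas : ∀ i, Measurable (c i) := fun i =>
    hc.elim (fun h => (h i).1.measurable) (fun h => (h i).1.measurable)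
  obtain ⟨γ₀, hγ₀⟩ : ∃ γ, IsEOTSolution c μ ν γ :=
    exists_isEOTSolution hN (fun i => hc.elim (fun h => (h i).1) (fun h => (h i).1)) fun i =>
      hc.elim (fun h => ⟨0, by rintro _ ⟨z, rfl⟩; exact (h i).2 z⟩) (fun h => (h i).2.2)
  have hequit : EOT c μ ν < ⊤ → ∀ γ, IsEOTSolution c μ ν γ →
      ∀ i, extIntegral (γ i) (c i) = EOT c μ ν := by
    intro hfin γ hγ
    refine hγ.extIntegral_eq_of_perturbation hN ?_
    rcases hc with h | h
    · exact exists_perturbation_of_nonneg hmeas (fun i => (h i).2) hγ.1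
        (hγ.maxCost_eq.trans_lt hfin)
    · exact exists_perturbation_of_neg hmeas (fun i => (h i).2.1) (fun i => (h i).2.2) hγ.1
  have hle : ∀ γ t, IsEquitableFeasible c μ ν γ t → EOT c μ ν ≤ t := fun γ t h =>
    (iInf₂_le γ h.1).trans_eq (h.maxCost_eq hN)
  have hneg : (∀ i, IsNegBddLSC (c i)) → EOT c μ ν < ⊤ := fun h => by
    rw [← hγ₀.maxCost_eq]
    refine (iSup_le fun i => ?_ : maxCost c γ₀ ≤ 0).trans_lt EReal.zero_lt_top
    rw [extIntegral_of_nonpos _ fun z => ((h i).2.1 z).le]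
    simp [EReal.coe_ennreal_nonneg]
  refine ⟨fun hfin => ⟨fun γ => ⟨fun h => ?_, ?_⟩, fun γ hγ i j => ?_⟩, ⟨?_, ?_⟩,
    fun h => ⟨hneg h, fun γ hγ => ⟨fun i j => ?_, fun hπ i => ?_⟩⟩⟩
  · exact ⟨EOT c μ ν, ⟨h.1, hequit hfin γ h⟩, hle⟩
  · rintro ⟨t, ht, hmin⟩
    refine ⟨ht.1, fun γ' hγ' => ?_⟩
    rw [ht.maxCost_eq hN]
    exact (hmin γ₀ _ ⟨hγ₀.1, hequit hfin γ₀ hγ₀⟩).trans (iInf₂_le γ' hγ')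
  · rw [hequit hfin γ hγ i, hequit hfin γ hγ j]
  · rcases lt_or_eq_of_le (le_top (a := EOT c μ ν)) with hfin | htop
    · exact ⟨γ₀, hγ₀.1, hequit hfin γ₀ hγ₀⟩
    · have h : ∀ i, IsNonnegLSC (c i) := hc.resolve_right fun h => (hneg h).ne htop
      have hπ := prod_mem_couplings μ ν
      refine ⟨_, average_mem_couplingDecompositions hN fun _ => hπ, fun i => ?_⟩
      -- With all mass at index `i` the other costs are zero, so the infinite value forces `c i` to
      -- have infinite integral against `μ.prod ν`.
      have hi : ∫⁻ z, ENNReal.ofReal (c i z) ∂(μ.prod ν) = ⊤ := by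
        obtain ⟨k, hk⟩ := maxCost_eq_extIntegral hN c (Pi.single i (μ.prod ν))
        have h1 : EOT c μ ν ≤ maxCost c (Pi.single i (μ.prod ν)) :=
          iInf₂_le _ (single_mem_couplingDecompositions hπ i)
        rw [htop, top_le_iff, hk, extIntegral_of_nonneg _ (h k).2,
          EReal.coe_ennreal_eq_top_iff] at h1
        by_cases hki : k = i
        · subst hki
          simpa using h1
        · simp [Pi.single_eq_of_ne hki] at h1
      rw [extIntegral_of_nonneg _ (h i).2, lintegral_smul_measure, hi, htop, smul_eq_mul,
        ENNReal.mul_top (by simp), EReal.coe_ennreal_top]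
  · rintro t ⟨γ, hγ⟩
    exact hle γ t hγ
  · rw [extIntegral_neg_of_nonpos _ fun z => ((h i).2.1 z).le,
      extIntegral_neg_of_nonpos _ fun z => ((h j).2.1 z).le,
      hequit (hneg h) γ hγ i, hequit (hneg h) γ hγ j]
  · choose π hπ hπ1 using hπ
    rw [extIntegral_neg_of_nonpos _ fun z => ((h i).2.1 z).le, EReal.le_neg]
    -- In the competitor `π k / N` every utility equals `1 / N`, so its maximal cost is `-1 / N`.
    refine (extIntegral_le_maxCost c γ i).trans
      ((hγ.2 _ (average_mem_couplingDecompositions hN hπ)).trans (iSup_le fun k => ?_))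
    have hk := hπ1 k
    rw [extIntegral_of_nonneg _ fun z => by linarith [(h k).2.1 z], ← EReal.coe_ennreal_one,
      EReal.coe_ennreal_eq_coe_ennreal_iff] at hk
    rw [extIntegral_of_nonpos _ fun z => ((h k).2.1 z).le, lintegral_smul_measure, hk, smul_eq_mul,
      mul_one, EReal.neg_le_neg_iff, one_div]
    have hinv : (N : ℝ≥0∞)⁻¹ = (((N : NNReal)⁻¹ : NNReal) : ℝ≥0∞) := by
      rw [ENNReal.coe_inv (by simp; omega), ENNReal.coe_natCast]
    rw [hinv]
    exact le_of_eq rfl
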